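/- Let $M$ be a smooth ($C^\infty$) manifold of dimension $n$, let $k\ge 2$ be an integer, and let $g$ be a pseudo-Riemannian metric on $M$ of class $C^k$ and of arbitrary signature (Riemannian metrics included). Let $d\in\mathbb{N}$ and let $F:T^*M\to\mathbb{R}$ be a function which is polynomial in momenta of degree $d$, that is, in local coordinates $x=(x^1,\dots,x^n)$ on $M$ and the corresponding coordinates $p=(p_1,\dots,p_n)$ on the cotangent spaces $$F(x,p)=\sum_{i_1,\dots,i_d=1}^n K^{i_1\dots i_d}(x)\,p_{i_1}\cdots p_{i_d},$$ where nothing (not even continuity or measurability) is assumed about the dependence of the coefficients $K^{i_1\dots i_d}$ on $x$. Suppose that $F$ is an integral of the geodesic flow of $g$, in the sense that for every geodesic $\gamma$ of $g$, defined on an open interval, the function $$t\mapsto F\bigl(\gamma(t),\,g(\dot\gamma(t),\cdot)\bigr)=\sum_{i_1,\dots,i_d=1}^n K_{i_1\dots i_d}(\gamma(t))\,\dot\gamma(t)^{i_1}\cdots\dot\gamma(t)^{i_d}$$ does not depend on $t$ (indices are lowered with $g$). Then $F$ is of class $C^{k-1}$ on $T^*M$. -/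

import Mathlib

open scoped Manifold ContDiff

noncomputable section

/-- A pseudo-Riemannian metric of class `C^k` and of arbitrary signature on an `n`-dimensional
manifold: a symmetric nondegenerate bilinear form on each tangent space which is `C^k` as a section
of the bundle of bilinear forms on the tangent bundle. -/
structure PseudoRiemannianMetric (n : ℕ) (k : ℕ∞ω) (M : Type*) [TopologicalSpace M]
    [ChartedSpace (EuclideanSpace ℝ (Fin n)) M] [IsManifold (𝓡 n) ∞ M] where
  /-- The bilinear form on the tangent space at `x`. -/
  val (x : M) : TangentSpace (𝓡 n) x →L[ℝ] TangentSpace (𝓡 n) x →L[ℝ] ℝ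
  symm (x : M) (v w : TangentSpace (𝓡 n) x) : val x v w = val x w v
  nondegenerate (x : M) (v : TangentSpace (𝓡 n) x) (hv : ∀ w, val x v w = 0) : v = 0
  contMDiff : ContMDiff (𝓡 n)
    ((𝓡 n).prod 𝓘(ℝ, EuclideanSpace ℝ (Fin n) →L[ℝ] EuclideanSpace ℝ (Fin n) →L[ℝ] ℝ)) k
    (fun x ↦ Bundle.TotalSpace.mk'
      (EuclideanSpace ℝ (Fin n) →L[ℝ] EuclideanSpace ℝ (Fin n) →L[ℝ] ℝ) x (val x))

/-- The cotangent bundle `T*M` of an `n`-dimensional manifold, with its manifold structure: the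
bundle of (continuous) linear functionals on the tangent spaces. Its points are pairs `⟨x, p⟩`. -/
abbrev CotangentBundle (n : ℕ) (M : Type*) [TopologicalSpace M]
    [ChartedSpace (EuclideanSpace ℝ (Fin n)) M] [IsManifold (𝓡 n) ∞ M] : Type _ :=
  Bundle.TotalSpace (EuclideanSpace ℝ (Fin n) →L[ℝ] ℝ)
    (fun x : M ↦ TangentSpace (𝓡 n) x →L[ℝ] ℝ)

namespace PseudoRiemannianMetric

variable {n : ℕ} {k : ℕ∞ω} {M : Type*} [TopologicalSpace M]
  [ChartedSpace (EuclideanSpace ℝ (Fin n)) M] [IsManifold (𝓡 n) ∞ M]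

/-- The matrix `(g_ij)` of the metric in the chart `e`, at the point of `M` with coordinates
`y ∈ e.target`: `g_ij(y) = g(∂_i, ∂_j)`. -/
def matrix (g : PseudoRiemannianMetric n k M)
    (e : OpenPartialHomeomorph M (EuclideanSpace ℝ (Fin n))) (y : EuclideanSpace ℝ (Fin n)) :
    Matrix (Fin n) (Fin n) ℝ :=
  Matrix.of fun i j ↦ g.val (e.symm y)
    (mfderiv (𝓡 n) (𝓡 n) e.symm y (EuclideanSpace.single i (1 : ℝ)))
    (mfderiv (𝓡 n) (𝓡 n) e.symm y (EuclideanSpace.single j (1 : ℝ)))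

/-- `∂_l g_ij` in the chart `e`. -/
def partialMatrix (g : PseudoRiemannianMetric n k M)
    (e : OpenPartialHomeomorph M (EuclideanSpace ℝ (Fin n))) (y : EuclideanSpace ℝ (Fin n))
    (l i j : Fin n) : ℝ :=
  fderiv ℝ (fun z ↦ g.matrix e z i j) y (EuclideanSpace.single l (1 : ℝ))

/-- The Christoffel symbols of the Levi-Civita connection in the chart `e`:
`Γ^i_ab = ½ ∑_l g^il (∂_a g_lb + ∂_b g_la - ∂_l g_ab)`. -/
def christoffel (g : PseudoRiemannianMetric n k M)
    (e : OpenPartialHomeomorph M (EuclideanSpace ℝ (Fin n))) (y : EuclideanSpace ℝ (Fin n))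
    (i a b : Fin n) : ℝ :=
  (1 / 2) * ∑ l, (g.matrix e y)⁻¹ i l *
    (g.partialMatrix e y a l b + g.partialMatrix e y b l a - g.partialMatrix e y l a b)

/-- `γ` satisfies at time `t` the geodesic equation
`γ̈^i + ∑_{a,b} Γ^i_ab γ̇^a γ̇^b = 0` in the coordinates of the chart `e`. -/
def GeodesicEquationAt (g : PseudoRiemannianMetric n k M)
    (e : OpenPartialHomeomorph M (EuclideanSpace ℝ (Fin n))) (γ : ℝ → M) (t : ℝ) : Prop :=
  ∀ i : Fin n, deriv (deriv fun s ↦ e (γ s)) t i +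
    ∑ a, ∑ b, g.christoffel e (e (γ t)) i a b *
      deriv (fun s ↦ e (γ s)) t a * deriv (fun s ↦ e (γ s)) t b = 0

/-- `γ` is an (affinely parametrized) geodesic of `g` on the open set `J` of times: it is `C^2`
there and satisfies the geodesic equation in local coordinates around each of its points. (The
equation is invariant under changes of coordinates, so the choice of the chart is immaterial.) -/
def IsGeodesicOn (g : PseudoRiemannianMetric n k M) (γ : ℝ → M) (J : Set ℝ) : Prop :=
  ContMDiffOn 𝓘(ℝ, ℝ) (𝓡 n) 2 γ J ∧
    ∀ t ∈ J, ∃ e ∈ atlas (EuclideanSpace ℝ (Fin n)) M,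
      γ t ∈ e.source ∧ g.GeodesicEquationAt e γ t

/-- The point of `T*M` over `γ t` whose momentum is the velocity of `γ` at time `t` with its index
lowered by the metric: `p = g(γ̇(t), ·)`. -/
def momentumLift (g : PseudoRiemannianMetric n k M) (γ : ℝ → M) (t : ℝ) : CotangentBundle n M :=
  ⟨γ t, g.val (γ t) (mfderiv 𝓘(ℝ, ℝ) (𝓡 n) γ t (1 : ℝ))⟩

/-- `F : T*M → ℝ`, not assumed to have any regularity, is an integral of the geodesic flow of `g`:
for every geodesic `γ`, defined on any open interval `J`, the function `t ↦ F(γ(t), g(γ̇(t), ·))`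
does not depend on `t`. -/
def IsIntegral (g : PseudoRiemannianMetric n k M) (F : CotangentBundle n M → ℝ) : Prop :=
  ∀ (γ : ℝ → M) (J : Set ℝ), IsOpen J → J.OrdConnected → g.IsGeodesicOn γ J →
    ∀ s ∈ J, ∀ t ∈ J, F (g.momentumLift γ s) = F (g.momentumLift γ t)

end PseudoRiemannianMetric

/-- `F : T*M → ℝ` is polynomial in momenta of degree `d`, i.e. of the form
`F(x,p) = ∑ K^{i_1 … i_d}(x) p_{i_1} ⋯ p_{i_d}`: at each point `x` there is a tensor `K` (a
`d`-linear form on the cotangent space, depending on `x` in an arbitrary way) with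
`F(x,p) = K(p, …, p)`. -/
def IsPolynomialInMomenta {n : ℕ} {M : Type*} [TopologicalSpace M]
    [ChartedSpace (EuclideanSpace ℝ (Fin n)) M] [IsManifold (𝓡 n) ∞ M]
    (d : ℕ) (F : CotangentBundle n M → ℝ) : Prop :=
  ∀ x : M, ∃ K : MultilinearMap ℝ (fun _ : Fin d ↦ (TangentSpace (𝓡 n) x →L[ℝ] ℝ)) ℝ,
    ∀ p : TangentSpace (𝓡 n) x →L[ℝ] ℝ, F ⟨x, p⟩ = K fun _ ↦ p

end

/-! Work in a chart and express `F` through velocities: a function H(x, v) that for each x is a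
homogeneous polynomial in v of degree d. Geodesics solve γ'' = -Q(γ, γ') with Q quadratic in the
velocity and of class C^{k-1}, since the Christoffel symbols cost one derivative.

Two nearby points x, y are joined by a geodesic that leaves y at time 0 with velocity V₀(x, y) and
reaches x at time 1 with velocity V₁(x, y), both C^{k-1} in (x, y) (`exists_connecting_solutions`,
the inverse function theorem on a space of accelerations). Conservation gives H(x, V₁(x, y)) = H(y,
V₀(x, y)). For y fixed, the right side is a fixed polynomial composed with V₀(·, y), hence C^{k-1}
in x, whatever the dependence of H on its base point.

Finitely many values determine an element of the finite dimensional space of homogeneous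
polynomials. Choosing y_i = x₀ - s e_i with e_i interpolation nodes and s small makes V₁(x, y_i)/s
close to e_i. The coefficients of H(x, ·) then solve an invertible linear system with C^{k-1} matrix
and right side, so they are C^{k-1} (`contDiffAt_of_conserved`). Raising the index of the momentum
with g^{ij} carries the result back to the cotangent bundle. -/

open Filter Topology

universe u

/-! ### Smoothness of superposition operators -/

section Superposition

variable {K E F : Type*} [TopologicalSpace K] [CompactSpace K]
  [NormedAddCommGroup E] [NormedSpace ℝ E] [NormedAddCommGroup F] [NormedSpace ℝ F]

/-- Pointwise application of a continuous family of continuous linear maps, as a continuous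
bilinear map. -/
noncomputable def ContinuousMap.pointwiseApplyL (K E F : Type*) [TopologicalSpace K]
    [CompactSpace K] [NormedAddCommGroup E] [NormedSpace ℝ E] [NormedAddCommGroup F]
    [NormedSpace ℝ F] : C(K, E →L[ℝ] F) →L[ℝ] C(K, E) →L[ℝ] C(K, F) :=
  LinearMap.mkContinuous₂
    (LinearMap.mk₂ ℝ (fun (A : C(K, E →L[ℝ] F)) (h : C(K, E)) ↦
      (⟨fun t ↦ A t (h t), A.continuous.clm_apply h.continuous⟩ : C(K, F)))
      (fun A B h ↦ by ext t; simp) (fun c A h ↦ by ext t; simp)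
      (fun A h h' ↦ by ext t; simp) (fun c A h ↦ by ext t; simp)) 1
    (fun A h ↦ by
      rw [ContinuousMap.norm_le _ (by positivity)]
      intro t
      rw [one_mul]
      exact ((A t).le_opNorm _).trans
        (by gcongr; exacts [A.norm_coe_le_norm t, h.norm_coe_le_norm t]))

/-- The range of u is compact, so the continuous f' oscillates little on balls of one common radius
about its points; the mean value inequality is then uniform in t. -/
theorem ContinuousMap.hasFDerivAt_comp_left {f : C(E, F)} {f' : C(E, E →L[ℝ] F)}
    (hf : ∀ x, HasFDerivAt f (f' x) x) (u : C(K, E)) :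
    HasFDerivAt (fun u : C(K, E) ↦ f.comp u)
      (ContinuousMap.pointwiseApplyL K E F (f'.comp u)) u := by
  refine .of_isLittleO ?_
  rw [Asymptotics.isLittleO_iff]
  intro c hc
  have hK : IsCompact (Set.range u) := isCompact_range u.continuous
  have := hK.uniformContinuousAt_of_continuousAt f' (fun x _ ↦ f'.continuous.continuousAt)
    (Metric.dist_mem_uniformity hc)
  rcases Metric.mem_uniformity_dist.1 this with ⟨δ, hδ, h⟩
  filter_upwards [Metric.ball_mem_nhds u hδ] with w hw
  rw [ContinuousMap.norm_le _ (by positivity)]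
  intro t
  have hwt : w t ∈ Metric.ball (u t) δ :=
    lt_of_le_of_lt (ContinuousMap.dist_apply_le_dist t) hw
  have key := (convex_ball (u t) δ).norm_image_sub_le_of_norm_hasFDerivWithin_le'
    (f := f) (f' := fun z ↦ f' z) (φ := f' (u t)) (C := c)
    (fun z _ ↦ (hf z).hasFDerivWithinAt) (fun z hz ↦ by
      have := h (a := u t) (b := z) (by rw [dist_comm]; exact hz) ⟨t, rfl⟩
      rw [← dist_eq_norm, dist_comm]
      exact le_of_lt this) (Metric.mem_ball_self hδ) hwt
  refine key.trans ?_
  gcongr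
  exact (w - u).norm_coe_le_norm t

/-- The superposition operator `u ↦ f ∘ u` on spaces of continuous maps is as smooth as `f`. -/
theorem ContinuousMap.contDiff_comp_left {m : ℕ} {E F : Type u}
    [NormedAddCommGroup E] [NormedSpace ℝ E] [NormedAddCommGroup F] [NormedSpace ℝ F]
    (f : C(E, F)) (hf : ContDiff ℝ m f) :
    ContDiff ℝ m (fun u : C(K, E) ↦ f.comp u) := by
  -- The derivative of the operator is built from the superposition operator of f', whose values lie
  -- in `E →L[ℝ] F`. Hence F varies in the induction and shares a universe with E.
  induction m generalizing F with
  | zero =>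
    exact contDiff_zero.2 (ContinuousMap.continuous_postcomp f)
  | succ m ih =>
    have hf' := contDiff_succ_iff_fderiv.1 (by exact_mod_cast hf : ContDiff ℝ ((m : ℕ∞ω) + 1) f)
    let f' : C(E, E →L[ℝ] F) := ⟨fderiv ℝ f, hf'.2.2.continuous⟩
    have hd (u : C(K, E)) := ContinuousMap.hasFDerivAt_comp_left (f := f) (f' := f')
      (fun x ↦ (hf'.1 x).hasFDerivAt) u
    push_cast
    refine contDiff_succ_iff_fderiv.2 ⟨fun u ↦ (hd u).differentiableAt, by simp, ?_⟩
    rw [funext fun u ↦ (hd u).fderiv]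
    exact (ContinuousMap.pointwiseApplyL K E F).contDiff.comp (ih f' hf'.2.2)

end Superposition

/-! ### Curves with prescribed end points and acceleration -/

section ConnectingCurves

theorem continuous_uncurry_extend {E : Type*} [NormedAddCommGroup E] :
    Continuous fun q : C(Set.Icc (-1 : ℝ) 2, E) × ℝ ↦
      q.1 (Set.projIcc (-1) 2 (by norm_num) q.2) :=
  continuous_fst.eval (continuous_projIcc.comp continuous_snd)

theorem continuous_extend {E : Type*} [NormedAddCommGroup E] (u : C(Set.Icc (-1 : ℝ) 2, E)) :
    Continuous fun s : ℝ ↦ u (Set.projIcc (-1) 2 (by norm_num) s) :=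
  u.continuous.comp continuous_projIcc

variable {E : Type*} [NormedAddCommGroup E] [NormedSpace ℝ E]

/-- The primitive vanishing at `0` of (the constant extension of) a continuous function on
`[-1, 2]`. -/
noncomputable def primitiveFun (u : C(Set.Icc (-1 : ℝ) 2, E)) (t : ℝ) : E :=
  ∫ s in (0 : ℝ)..t, u (Set.projIcc (-1) 2 (by norm_num) s)

theorem continuous_primitiveFun :
    Continuous fun q : C(Set.Icc (-1 : ℝ) 2, E) × ℝ ↦ primitiveFun q.1 q.2 := by
  refine intervalIntegral.continuous_parametric_intervalIntegral_of_continuous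
    (f := fun (q : C(Set.Icc (-1 : ℝ) 2, E) × ℝ) (s : ℝ) ↦
      q.1 (Set.projIcc (-1) 2 (by norm_num) s)) ?_ continuous_snd
  exact continuous_uncurry_extend.comp
    ((continuous_fst.comp continuous_fst).prodMk continuous_snd)

theorem primitiveFun_add (u v : C(Set.Icc (-1 : ℝ) 2, E)) (t : ℝ) :
    primitiveFun (u + v) t = primitiveFun u t + primitiveFun v t :=
  intervalIntegral.integral_add ((continuous_extend u).intervalIntegrable _ _)
    ((continuous_extend v).intervalIntegrable _ _)

theorem primitiveFun_smul (c : ℝ) (u : C(Set.Icc (-1 : ℝ) 2, E)) (t : ℝ) :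
    primitiveFun (c • u) t = c • primitiveFun u t :=
  intervalIntegral.integral_smul _ _

@[simp]
theorem primitiveFun_zero_right (u : C(Set.Icc (-1 : ℝ) 2, E)) : primitiveFun u 0 = 0 := by
  simp [primitiveFun]

@[simp]
theorem primitiveFun_zero_left (t : ℝ) :
    primitiveFun (0 : C(Set.Icc (-1 : ℝ) 2, E)) t = 0 := by
  simp [primitiveFun]

theorem hasDerivAt_primitiveFun [CompleteSpace E] (u : C(Set.Icc (-1 : ℝ) 2, E)) (t : ℝ) :
    HasDerivAt (primitiveFun u) (u (Set.projIcc (-1) 2 (by norm_num) t)) t :=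
  intervalIntegral.integral_hasDerivAt_right ((continuous_extend u).intervalIntegrable _ _)
    ((continuous_extend u).stronglyMeasurableAtFilter _ _) (continuous_extend u).continuousAt

/-- The primitive vanishing at `0`, as a continuous linear operator on `C([-1, 2], E)`. -/
noncomputable def primitiveL : C(Set.Icc (-1 : ℝ) 2, E) →L[ℝ] C(Set.Icc (-1 : ℝ) 2, E) where
  toFun u := ⟨fun t ↦ primitiveFun u t,
    continuous_primitiveFun.comp (continuous_const.prodMk continuous_subtype_val)⟩
  map_add' u v := by ext t; exact primitiveFun_add u v t
  map_smul' c u := by ext t; exact primitiveFun_smul c u t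
  cont := ContinuousMap.continuous_of_continuous_uncurry _
    (continuous_primitiveFun.comp
      (continuous_fst.prodMk (continuous_subtype_val.comp continuous_snd)))

/-- The curve with acceleration `u` on `[-1, 2]` that is at `z.2` at time `0` and at `z.1` at
time `1`. -/
noncomputable def connectingCurve (q : (E × E) × C(Set.Icc (-1 : ℝ) 2, E)) (t : ℝ) : E :=
  q.1.2 + t • (q.1.1 - q.1.2) + primitiveFun (primitiveL q.2) t
    - t • primitiveFun (primitiveL q.2) 1

/-- The velocity of `connectingCurve`. -/
noncomputable def connectingVelocity (q : (E × E) × C(Set.Icc (-1 : ℝ) 2, E)) (t : ℝ) : E :=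
  q.1.1 - q.1.2 + primitiveFun q.2 t - primitiveFun (primitiveL q.2) 1

theorem connectingCurve_zero (q : (E × E) × C(Set.Icc (-1 : ℝ) 2, E)) :
    connectingCurve q 0 = q.1.2 := by
  simp [connectingCurve]

theorem connectingCurve_one (q : (E × E) × C(Set.Icc (-1 : ℝ) 2, E)) :
    connectingCurve q 1 = q.1.1 := by
  simp [connectingCurve]

theorem hasDerivAt_connectingCurve [CompleteSpace E] (q : (E × E) × C(Set.Icc (-1 : ℝ) 2, E))
    {t : ℝ} (ht : t ∈ Set.Ioo (-1 : ℝ) 2) :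
    HasDerivAt (connectingCurve q) (connectingVelocity q t) t := by
  have h1 : HasDerivAt (fun t : ℝ ↦ t • (q.1.1 - q.1.2)) ((1 : ℝ) • (q.1.1 - q.1.2)) t :=
    (hasDerivAt_id t).smul_const _
  have h2 : HasDerivAt (fun t : ℝ ↦ t • primitiveFun (primitiveL q.2) 1)
      ((1 : ℝ) • primitiveFun (primitiveL q.2) 1) t :=
    (hasDerivAt_id t).smul_const _
  have h3 := hasDerivAt_primitiveFun (primitiveL q.2) t
  rw [Set.projIcc_of_mem _ (Set.Ioo_subset_Icc_self ht)] at h3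
  have h := ((h1.const_add q.1.2).add h3).sub h2
  rw [one_smul, one_smul] at h
  exact h

theorem hasDerivAt_connectingVelocity [CompleteSpace E]
    (q : (E × E) × C(Set.Icc (-1 : ℝ) 2, E)) {t : ℝ} (ht : t ∈ Set.Ioo (-1 : ℝ) 2) :
    HasDerivAt (connectingVelocity q) (q.2 ⟨t, Set.Ioo_subset_Icc_self ht⟩) t := by
  have h3 := hasDerivAt_primitiveFun q.2 t
  rw [Set.projIcc_of_mem _ (Set.Ioo_subset_Icc_self ht)] at h3
  exact (h3.const_add _).sub_const _

/-- The curve `connectingCurve` together with its velocity, as a continuous linear function of the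
end points and of the acceleration. -/
noncomputable def connectingLift :
    ((E × E) × C(Set.Icc (-1 : ℝ) 2, E)) →L[ℝ] C(Set.Icc (-1 : ℝ) 2, E × E) :=
  have h1 : Continuous fun r : ((E × E) × C(Set.Icc (-1 : ℝ) 2, E)) × ℝ ↦
      connectingCurve r.1 r.2 := by
    have h2 : Continuous fun r : ((E × E) × C(Set.Icc (-1 : ℝ) 2, E)) × ℝ ↦
        primitiveFun (primitiveL r.1.2) r.2 :=
      continuous_primitiveFun.comp ((primitiveL.continuous.comp (by fun_prop)).prodMk (by fun_prop))
    have h3 : Continuous fun r : ((E × E) × C(Set.Icc (-1 : ℝ) 2, E)) × ℝ ↦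
        primitiveFun (primitiveL r.1.2) 1 :=
      continuous_primitiveFun.comp ((primitiveL.continuous.comp (by fun_prop)).prodMk (by fun_prop))
    unfold connectingCurve
    fun_prop
  have h2 : Continuous fun r : ((E × E) × C(Set.Icc (-1 : ℝ) 2, E)) × ℝ ↦
      connectingVelocity r.1 r.2 := by
    have h2 : Continuous fun r : ((E × E) × C(Set.Icc (-1 : ℝ) 2, E)) × ℝ ↦
        primitiveFun r.1.2 r.2 :=
      continuous_primitiveFun.comp ((by fun_prop : Continuous fun r :
        ((E × E) × C(Set.Icc (-1 : ℝ) 2, E)) × ℝ ↦ r.1.2).prodMk (by fun_prop))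
    have h3 : Continuous fun r : ((E × E) × C(Set.Icc (-1 : ℝ) 2, E)) × ℝ ↦
        primitiveFun (primitiveL r.1.2) 1 :=
      continuous_primitiveFun.comp ((primitiveL.continuous.comp (by fun_prop)).prodMk (by fun_prop))
    unfold connectingVelocity
    fun_prop
  { toFun := fun q ↦ ⟨fun t ↦ (connectingCurve q t, connectingVelocity q t),
      (h1.prodMk h2).comp (continuous_const.prodMk continuous_subtype_val)⟩
    map_add' := fun q r ↦ by
      ext t
      · simp only [connectingCurve, Prod.fst_add, Prod.snd_add, map_add, primitiveFun_add,
          ContinuousMap.coe_mk, ContinuousMap.add_apply]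
        module
      · simp only [connectingVelocity, Prod.fst_add, Prod.snd_add, map_add, primitiveFun_add,
          ContinuousMap.coe_mk, ContinuousMap.add_apply]
        module
    map_smul' := fun c q ↦ by
      ext t
      · simp only [connectingCurve, Prod.smul_fst, Prod.smul_snd, map_smul, primitiveFun_smul,
          ContinuousMap.coe_mk, ContinuousMap.smul_apply, RingHom.id_apply]
        module
      · simp only [connectingVelocity, Prod.smul_fst, Prod.smul_snd, map_smul, primitiveFun_smul,
          ContinuousMap.coe_mk, ContinuousMap.smul_apply, RingHom.id_apply]
        module
    cont := ContinuousMap.continuous_of_continuous_uncurry _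
      ((h1.prodMk h2).comp
        (continuous_fst.prodMk (continuous_subtype_val.comp continuous_snd))) }

end ConnectingCurves

/-! ### The two-point boundary value problem -/

section Connecting

/-- A second order equation `γ'' = -Q(γ, γ')` whose right hand side vanishes to second order at
`(x₀, 0)` has, for end points close to `x₀`, solutions on `(-1, 2)` that are at prescribed points at
the times `0` and `1`, and whose velocities there depend on these points as smoothly as `Q` does. -/
theorem exists_connecting_solutions {E : Type u} [NormedAddCommGroup E] [NormedSpace ℝ E]
    [CompleteSpace E] {m : ℕ} (hm : m ≠ 0)
    {Q : E × E → E} (hQ : ContDiff ℝ m Q) {x₀ : E} (hQ0 : Q (x₀, 0) = 0)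
    (hQ' : HasFDerivAt Q (0 : E × E →L[ℝ] E) (x₀, 0)) {W : Set E} (hW : W ∈ 𝓝 x₀) :
    ∃ V₀ V₁ : E × E → E, (∀ᶠ z in 𝓝 (x₀, x₀), ContDiffAt ℝ m V₀ z ∧ ContDiffAt ℝ m V₁ z) ∧
      V₁ (x₀, x₀) = 0 ∧
      HasFDerivAt V₁ (ContinuousLinearMap.fst ℝ E E - ContinuousLinearMap.snd ℝ E E) (x₀, x₀) ∧
      ∀ᶠ z in 𝓝 (x₀, x₀), ∃ γ γ' : ℝ → E,
        (∀ t ∈ Set.Ioo (-1 : ℝ) 2, γ t ∈ W ∧ HasDerivAt γ (γ' t) t ∧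
          HasDerivAt γ' (-Q (γ t, γ' t)) t) ∧
        γ 0 = z.2 ∧ γ 1 = z.1 ∧ γ' 0 = V₀ z ∧ γ' 1 = V₁ z := by
  -- The interval exceeds [0, 1] because the solution must live on an open interval containing both
  -- 0 and 1.
  let K := Set.Icc (-1 : ℝ) 2
  let Qc : C(E × E, E) := ⟨Q, hQ.continuous⟩
  let Q' : C(E × E, E × E →L[ℝ] E) :=
    ⟨fderiv ℝ Q, hQ.continuous_fderiv (by exact_mod_cast hm)⟩
  let N : C(K, E × E) → C(K, E) := fun w ↦ Qc.comp w
  have hN : ContDiff ℝ m N := ContinuousMap.contDiff_comp_left Qc hQ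
  -- The unknown is the acceleration u. The equation is u + Q(γ, γ') = 0, where (γ, γ') depends
  -- linearly on end points and u; keeping the end points as a component makes the local inverse
  -- yield the dependence on them.
  let Φ : (E × E) × C(K, E) → (E × E) × C(K, E) :=
    fun q ↦ (q.1, q.2 + N (connectingLift q))
  have hΦ : ContDiff ℝ m Φ :=
    contDiff_fst.prodMk (contDiff_snd.add (hN.comp (connectingLift (E := E)).contDiff))
  let a : (E × E) × C(K, E) := ((x₀, x₀), 0)
  have hLa : connectingLift a = ContinuousMap.const K (x₀, (0 : E)) := by
    ext t
    · change connectingCurve a t = x₀; simp [connectingCurve, a]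
    · change connectingVelocity a t = 0; simp [connectingVelocity, a]
  have hNa : N (connectingLift a) = 0 := by
    rw [hLa]; ext t; exact hQ0
  have hΦa : Φ a = a := by
    simp [Φ, hNa, a]
  have hd : HasFDerivAt Φ
      ((ContinuousLinearEquiv.refl ℝ ((E × E) × C(K, E)) : _ ≃L[ℝ] _) : _ →L[ℝ] _) a := by
    -- At the constant curve x₀ the derivative of Q is zero, so the nonlinear term does not
    -- contribute and Φ has identity derivative.
    have h1 : HasFDerivAt N (0 : C(K, E × E) →L[ℝ] C(K, E)) (connectingLift a) := by
      have h2 := ContinuousMap.hasFDerivAt_comp_left (f := Qc) (f' := Q')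
        (fun x ↦ (hQ.differentiable (by exact_mod_cast hm) x).hasFDerivAt) (connectingLift a)
      convert h2 using 1
      ext h t
      rw [hLa]
      change 0 = fderiv ℝ Q (x₀, 0) (h t)
      rw [hQ'.fderiv]; rfl
    have h3 : HasFDerivAt (fun q ↦ N (connectingLift q)) _ a :=
      HasFDerivAt.comp a h1 (connectingLift (E := E)).hasFDerivAt
    have h4 := hasFDerivAt_fst.prodMk (hasFDerivAt_snd.add h3)
    rw [ContinuousLinearMap.zero_comp, add_zero, ContinuousLinearMap.fst_prod_snd] at h4
    exact h4
  have hm' : (m : ℕ∞ω) ≠ 0 := by exact_mod_cast hm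
  have hs := hΦ.contDiffAt.hasStrictFDerivAt' hd hm'
  let S := hs.localInverse Φ _ a
  have hSa : S a = a := by
    have := hs.localInverse_apply_image
    rwa [hΦa] at this
  have hS : ContDiffAt ℝ m S a := by
    have := hΦ.contDiffAt.to_localInverse hd hm'
    rwa [hΦa] at this
  have hS' : HasFDerivAt S (ContinuousLinearMap.id ℝ _) a := by
    have := hs.to_localInverse.hasFDerivAt
    rwa [hΦa] at this
  have hSr : ∀ᶠ y in 𝓝 a, Φ (S y) = y := by
    have := hs.eventually_right_inverse
    rwa [hΦa] at this
  -- Solutions with end points z are the preimages of (z, 0) under Φ.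
  let ι : E × E →L[ℝ] (E × E) × C(K, E) := ContinuousLinearMap.inl ℝ _ _
  have hιa : ι (x₀, x₀) = a := rfl
  have hι : Tendsto ι (𝓝 (x₀, x₀)) (𝓝 a) := by
    rw [← hιa]; exact ι.continuous.tendsto _
  let s : E × E → C(K, E × E) := fun z ↦ connectingLift (S (ι z))
  have hsc : ContDiffAt ℝ m s (x₀, x₀) :=
    connectingLift.contDiff.contDiffAt.comp _ (hS.comp (x₀, x₀) ι.contDiff.contDiffAt)
  have hs' : HasFDerivAt s (connectingLift ∘L ι) (x₀, x₀) := by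
    have h1 : HasFDerivAt (fun z ↦ S (ι z)) _ (x₀, x₀) :=
      HasFDerivAt.comp (x₀, x₀) hS' ι.hasFDerivAt
    exact connectingLift.hasFDerivAt.comp (x₀, x₀) h1
  have hs0 : s (x₀, x₀) = ContinuousMap.const K (x₀, (0 : E)) := by
    rw [← hLa]; simp only [s, hιa, hSa]
  let ev (t : K) : C(K, E × E) →L[ℝ] E :=
    ContinuousLinearMap.snd ℝ E E ∘L ContinuousMap.evalCLM ℝ t
  let t₀ : K := ⟨0, by norm_num, by norm_num⟩
  let t₁ : K := ⟨1, by norm_num, by norm_num⟩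
  refine ⟨fun z ↦ ev t₀ (s z), fun z ↦ ev t₁ (s z), ?_, ?_, ?_, ?_⟩
  · filter_upwards [hsc.eventually (by simp)] with z hz
    exact ⟨(ev t₀).contDiff.contDiffAt.comp z hz, (ev t₁).contDiff.contDiffAt.comp z hz⟩
  · beta_reduce; rw [hs0]; rfl
  · have h1 := (ev t₁).hasFDerivAt.comp (x₀, x₀) hs'
    have h2 : ev t₁ ∘L connectingLift ∘L ι =
        ContinuousLinearMap.fst ℝ E E - ContinuousLinearMap.snd ℝ E E := by
      refine ContinuousLinearMap.ext fun v ↦ ?_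
      -- To first order the connecting curve has zero acceleration, so its velocity is the
      -- difference of the end points.
      change v.1 - v.2 + primitiveFun 0 1 - primitiveFun (primitiveL 0) 1 = v.1 - v.2
      simp
    rwa [h2] at h1
  -- Staying in W throughout the compact interval is an open condition on curves.
  · have hopen : IsOpen {w : C(K, E × E) | Set.MapsTo w Set.univ (Prod.fst ⁻¹' interior W)} :=
      ContinuousMap.isOpen_setOfPred_mapsTo isCompact_univ (isOpen_interior.preimage continuous_fst)
    have hmem : ∀ᶠ z in 𝓝 (x₀, x₀), Set.MapsTo (s z) Set.univ (Prod.fst ⁻¹' interior W) := by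
      refine hsc.continuousAt.eventually_mem (hopen.mem_nhds ?_)
      rw [hs0]
      intro t _
      exact mem_interior_iff_mem_nhds.2 hW
    filter_upwards [hmem, hι.eventually hSr] with z hz hzr
    have h1 : (S (ι z)).1 = z := congrArg Prod.fst hzr
    have h2 : (S (ι z)).2 + N (s z) = 0 := congrArg Prod.snd hzr
    refine ⟨connectingCurve (S (ι z)), connectingVelocity (S (ι z)), ?_, ?_, ?_, rfl, rfl⟩
    · intro t ht
      refine ⟨interior_subset (hz (Set.mem_univ ⟨t, Set.Ioo_subset_Icc_self ht⟩)),
        hasDerivAt_connectingCurve _ ht, ?_⟩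
      have h3 := hasDerivAt_connectingVelocity (S (ι z)) ht
      rw [eq_neg_of_add_eq_zero_left h2] at h3
      exact h3
    · rw [connectingCurve_zero, h1]
    · rw [connectingCurve_one, h1]

end Connecting

/-! ### Interpolation nodes -/

section Interpolation

/-- A finite dimensional space of functions has interpolation nodes: points `e i` and functions
`ℓ j` in the space with `ℓ j (e i) = δ_ij` that generate it. -/
theorem exists_interpolation_nodes {X : Type*} (P : Submodule ℝ (X → ℝ)) [FiniteDimensional ℝ P] :
    ∃ (N : ℕ) (e : Fin N → X) (l : Fin N → X → ℝ), (∀ j, l j ∈ P) ∧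
      (∀ i j, l j (e i) = (1 : Matrix (Fin N) (Fin N) ℝ) i j) ∧
      ∀ f ∈ P, ∃ c : Fin N → ℝ, ∀ x, f x = ∑ j, c j * l j x := by
  let ev : X → Module.Dual ℝ P := fun x ↦ (LinearMap.proj x) ∘ₗ P.subtype
  have hsep (f : P) (hf : ∀ x, ev x f = 0) : f = 0 := Subtype.ext (funext hf)
  -- Evaluations separate the elements of P, so by finite dimensional duality they span the dual; a
  -- basis extracted from them gives the nodes, and its dual basis the functions `l j`.
  have hspan : ⊤ ≤ Submodule.span ℝ (Set.range ev) := by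
    rw [top_le_iff]
    have h1 : (Submodule.span ℝ (Set.range ev)).dualCoannihilator = ⊥ := by
      rw [eq_bot_iff]
      intro f hf
      rw [Submodule.mem_dualCoannihilator] at hf
      exact hsep f fun x ↦ hf _ (Submodule.subset_span ⟨x, rfl⟩)
    rw [← Subspace.dualCoannihilator_dualAnnihilator_eq
      (W := Submodule.span ℝ (Set.range ev)), h1, Submodule.dualAnnihilator_bot]
  obtain ⟨κ, a, -, ha, hli⟩ := exists_linearIndependent' ℝ ev
  have hspan' : ⊤ ≤ Submodule.span ℝ (Set.range (ev ∘ a)) := by rwa [ha]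
  let b' := Module.Basis.mk hli hspan'
  have : Fintype κ := FiniteDimensional.fintypeBasisIndex b'
  let b := b'.reindex (Fintype.equivFin κ)
  let e : Fin (Fintype.card κ) → X := fun i ↦ a ((Fintype.equivFin κ).symm i)
  have hb (i) : b i = ev (e i) := by simp [b, b', e]
  let T : P →ₗ[ℝ] (Fin (Fintype.card κ) → ℝ) := LinearMap.pi fun i ↦ b i
  have hT : Function.Injective T := by
    rw [← LinearMap.ker_eq_bot, eq_bot_iff]
    intro f hf
    have h1 (φ : Module.Dual ℝ P) : φ f = 0 := by
      rw [← b.sum_repr φ, LinearMap.sum_apply]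
      refine Finset.sum_eq_zero fun i _ ↦ ?_
      have : b i f = 0 := congrFun (LinearMap.mem_ker.1 hf) i
      simp [this]
    exact hsep f fun x ↦ h1 _
  have hdim : Module.finrank ℝ P = Module.finrank ℝ (Fin (Fintype.card κ) → ℝ) := by
    rw [← Subspace.dual_finrank_eq, Module.finrank_eq_card_basis b, Module.finrank_pi]
  let T' := LinearEquiv.ofInjectiveOfFinrankEq T hT hdim
  have hT' (f : P) (i) : T' f i = (f : X → ℝ) (e i) := by
    change b i f = _
    rw [hb]; rfl
  refine ⟨_, e, fun j ↦ (T'.symm (Pi.single j 1) : P), fun j ↦ Subtype.mem _, fun i j ↦ ?_,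
    fun f hf ↦ ⟨T' ⟨f, hf⟩, fun x ↦ ?_⟩⟩
  · beta_reduce; rw [← hT', LinearEquiv.apply_symm_apply, Matrix.one_apply, Pi.single_apply]
  · have h1 : (⟨f, hf⟩ : P) = ∑ j, T' ⟨f, hf⟩ j • T'.symm (Pi.single j 1) := by
      apply T'.injective
      ext i
      simp [Pi.single_apply]
    have h2 := congrArg (fun p : P ↦ (p : X → ℝ) x) h1
    simpa using h2

end Interpolation

/-! ### Smooth dependence of inverse matrices -/

section MatrixSmooth

variable {G : Type*} [NormedAddCommGroup G] [NormedSpace ℝ G] {ι : Type*} [Fintype ι]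
  [DecidableEq ι] {m : ℕ∞ω} {x : G}

theorem ContDiffAt.matrix_det {A : G → Matrix ι ι ℝ}
    (hA : ∀ i j, ContDiffAt ℝ m (fun y ↦ A y i j) x) : ContDiffAt ℝ m (fun y ↦ (A y).det) x := by
  simp only [Matrix.det_apply]
  exact ContDiffAt.sum fun σ _ ↦ (contDiffAt_prod fun i _ ↦ hA _ _).const_smul _

/-- Cramer's rule: entries of the adjugate are determinants of matrices with one row replaced by a
constant. -/
theorem ContDiffAt.matrix_inv_apply {A : G → Matrix ι ι ℝ}
    (hA : ∀ i j, ContDiffAt ℝ m (fun y ↦ A y i j) x) (hx : (A x).det ≠ 0) (i j : ι) :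
    ContDiffAt ℝ m (fun y ↦ (A y)⁻¹ i j) x := by
  simp only [Matrix.inv_def, Matrix.smul_apply, Matrix.adjugate_apply, Ring.inverse_eq_inv',
    smul_eq_mul]
  refine (ContDiffAt.inv (ContDiffAt.matrix_det hA) hx).mul (ContDiffAt.matrix_det fun k l ↦ ?_)
  by_cases h : k = j
  · subst h; simpa using contDiffAt_const
  · simpa [Matrix.updateRow_ne h] using hA k l

end MatrixSmooth

/-! ### Regularity from conservation -/

section LocalRegularity

/-- Let `H` be a function of position and velocity whose restriction to each fibre belongs to a
fixed finite dimensional space of homogeneous polynomials. If it is constant along the solutions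
of `γ'' = -Q(γ, γ')`, then it is as smooth as `Q`. -/
theorem contDiffAt_of_conserved {E : Type u} [NormedAddCommGroup E] [NormedSpace ℝ E]
    [CompleteSpace E] {m d : ℕ} (hm : m ≠ 0)
    {Q : E × E → E} (hQ : ContDiff ℝ m Q) {x₀ : E} (hQ0 : Q (x₀, 0) = 0)
    (hQ' : HasFDerivAt Q (0 : E × E →L[ℝ] E) (x₀, 0)) {W : Set E} (hW : W ∈ 𝓝 x₀)
    (P : Submodule ℝ (E → ℝ)) [FiniteDimensional ℝ P] (hPs : ∀ f ∈ P, ContDiff ℝ m f)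
    (hPh : ∀ f ∈ P, ∀ (c : ℝ) (v : E), f (c • v) = c ^ d * f v)
    {H : E → E → ℝ} (hH : ∀ x ∈ W, H x ∈ P)
    (hcons : ∀ γ γ' : ℝ → E, (∀ t ∈ Set.Ioo (-1 : ℝ) 2, γ t ∈ W ∧ HasDerivAt γ (γ' t) t ∧
      HasDerivAt γ' (-Q (γ t, γ' t)) t) → H (γ 0) (γ' 0) = H (γ 1) (γ' 1)) (v₀ : E) :
    ContDiffAt ℝ m (fun z : E × E ↦ H z.1 z.2) (x₀, v₀) := by
  obtain ⟨N, e, l, hl, hle, hspan⟩ := exists_interpolation_nodes P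
  obtain ⟨V₀, V₁, hVs, hV1, hV1', hV⟩ := exists_connecting_solutions hm hQ hQ0 hQ' hW
  -- the nodes are approached by the rescaled velocities at `x₀` of connecting curves
  let y (s : ℝ) (i : Fin N) : E := x₀ - s • e i
  have hy (i : Fin N) : ContinuousAt (fun s ↦ (x₀, y s i)) 0 := by
    simp only [y]; fun_prop
  have hlim (i : Fin N) :
      -- V₁ vanishes at (x₀, x₀) with derivative -id in the second variable, so V₁(x₀, x₀ - s e_i) =
      -- s e_i + o(s).
      Tendsto (fun s : ℝ ↦ s⁻¹ • V₁ (x₀, y s i)) (𝓝[≠] 0) (𝓝 (e i)) := by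
    have h1 : HasDerivAt (fun s : ℝ ↦ (x₀, y s i)) (0, -e i) 0 := by
      have h2 : HasDerivAt (fun s : ℝ ↦ y s i) (-((1 : ℝ) • e i)) 0 :=
        ((hasDerivAt_id (0 : ℝ)).smul_const (e i)).const_sub x₀
      rw [one_smul] at h2
      exact (hasDerivAt_const _ _).prodMk h2
    have h0 : (x₀, y 0 i) = (x₀, x₀) := by simp [y]
    have h3 : HasDerivAt (fun s : ℝ ↦ V₁ (x₀, y s i)) _ 0 :=
      HasFDerivAt.comp_hasDerivAt (0 : ℝ) (by rw [h0]; exact hV1') h1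
    have h4 := h3.tendsto_slope_zero
    simpa [h0, hV1] using h4
  have hdet : ∀ᶠ s : ℝ in 𝓝[≠] 0,
      (Matrix.of fun i j ↦ l j (s⁻¹ • V₁ (x₀, y s i))).det ≠ 0 := by
    have h1 : Tendsto (fun s : ℝ ↦ (Matrix.of fun i j ↦ l j (s⁻¹ • V₁ (x₀, y s i))))
        (𝓝[≠] 0) (𝓝 (1 : Matrix (Fin N) (Fin N) ℝ)) := by
      refine tendsto_pi_nhds.2 fun i ↦ tendsto_pi_nhds.2 fun j ↦ ?_
      rw [← hle i j]
      exact ((hPs _ (hl j)).continuous.tendsto _).comp (hlim i)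
    have h2 := ((continuous_id.matrix_det).tendsto (1 : Matrix (Fin N) (Fin N) ℝ)).comp h1
    exact h2.eventually_ne (by simp)
  let R : E × E → Prop := fun z ↦ (ContDiffAt ℝ m V₀ z ∧ ContDiffAt ℝ m V₁ z) ∧
    ∃ γ γ' : ℝ → E, (∀ t ∈ Set.Ioo (-1 : ℝ) 2, γ t ∈ W ∧ HasDerivAt γ (γ' t) t ∧
        HasDerivAt γ' (-Q (γ t, γ' t)) t) ∧
      γ 0 = z.2 ∧ γ 1 = z.1 ∧ γ' 0 = V₀ z ∧ γ' 1 = V₁ z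
  have hgood : ∀ᶠ s : ℝ in 𝓝[≠] 0, ∀ i, ∀ᶠ z in 𝓝 (x₀, y s i), R z := by
    rw [eventually_all]
    intro i
    have h0 : (x₀, y 0 i) = (x₀, x₀) := by simp [y]
    have h1 := (hVs.and hV).eventually_nhds
    rw [← h0] at h1
    exact ((hy i).eventually h1).filter_mono nhdsWithin_le_nhds
  have hyW : ∀ᶠ s : ℝ in 𝓝[≠] 0, ∀ i, y s i ∈ W := by
    rw [eventually_all]
    intro i
    have h0 : y 0 i = x₀ := by simp [y]
    have : ContinuousAt (fun s ↦ y s i) 0 := by simp only [y]; fun_prop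
    exact (this.eventually_mem (by rwa [h0])).filter_mono nhdsWithin_le_nhds
  -- From here s, and with it the starting points `y s i`, is fixed; only x moves.
  obtain ⟨s, hs, hsdet, hsgood, hsW⟩ :=
    ((eventually_mem_nhdsWithin (a := (0 : ℝ)) (s := {0}ᶜ)).and
      (hdet.and (hgood.and hyW))).exists
  have hs0 : s ≠ 0 := hs
  let A : E → Matrix (Fin N) (Fin N) ℝ := fun x ↦ Matrix.of fun i j ↦ l j (s⁻¹ • V₁ (x, y s i))
  let f : E → Fin N → ℝ := fun x i ↦ s⁻¹ ^ d * H (y s i) (V₀ (x, y s i))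
  have hpair (i : Fin N) : ContDiffAt ℝ m (fun x ↦ (x, y s i)) x₀ := by fun_prop
  have hA (i j) : ContDiffAt ℝ m (fun x ↦ A x i j) x₀ :=
    (hPs _ (hl j)).contDiffAt.comp x₀
      (((hsgood i).self_of_nhds.1.2.comp x₀ (hpair i)).const_smul _)
  -- H enters only at the fixed base point `y s i`, where it is a polynomial in the velocity; no
  -- regularity in the base point is used.
  have hf (i) : ContDiffAt ℝ m (fun x ↦ f x i) x₀ :=
    contDiffAt_const.mul ((hPs _ (hH _ (hsW i))).contDiffAt.comp x₀
      ((hsgood i).self_of_nhds.1.1.comp x₀ (hpair i)))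
  have hAinv := ContDiffAt.matrix_inv_apply hA hsdet
  have hformula : ∀ᶠ x in 𝓝 x₀, ∀ v, H x v = ∑ j, (∑ i, (A x)⁻¹ j i * f x i) * l j v := by
    have h1 : ∀ᶠ x in 𝓝 x₀, (A x).det ≠ 0 :=
      (ContDiffAt.matrix_det hA).continuousAt.eventually_ne hsdet
    have h2 : ∀ᶠ x in 𝓝 x₀, ∀ i, R (x, y s i) :=
      eventually_all.2 fun i ↦ (hpair i).continuousAt.eventually (hsgood i)
    filter_upwards [h1, h2, hW] with x hx hxV hxW v
    obtain ⟨c, hc⟩ := hspan _ (hH x hxW)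
    have h3 : (A x).mulVec c = f x := by
      ext i
      obtain ⟨γ, γ', hγ, h0, h1, h0', h1'⟩ := (hxV i).2
      have h4 := hcons γ γ' hγ
      rw [h0, h1, h0', h1'] at h4
      -- Conservation along the connecting curve, rescaled: homogeneity turns s⁻¹ inside H into the
      -- factor s⁻ᵈ of `f`.
      have h5 : f x i = H x (s⁻¹ • V₁ (x, y s i)) := by
        rw [hPh _ (hH x hxW), ← h4]
      rw [h5, hc]
      simp [Matrix.mulVec, dotProduct, A, mul_comm]
    have h6 : c = (A x)⁻¹.mulVec (f x) := by
      rw [← h3, Matrix.mulVec_mulVec, Matrix.nonsing_inv_mul _ (isUnit_iff_ne_zero.2 hx),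
        Matrix.one_mulVec]
    rw [hc, h6]
    rfl
  have h7 : (fun z : E × E ↦ H z.1 z.2) =ᶠ[𝓝 (x₀, v₀)]
      fun z ↦ ∑ j, (∑ i, (A z.1)⁻¹ j i * f z.1 i) * l j z.2 :=
    (continuousAt_fst.eventually hformula).mono fun z hz ↦ hz z.2
  refine ContDiffAt.congr_of_eventuallyEq ?_ h7
  have hfst : ContDiffAt ℝ m (Prod.fst : E × E → E) (x₀, v₀) := contDiffAt_fst
  exact ContDiffAt.sum fun j _ ↦ ContDiffAt.mul
    (ContDiffAt.sum fun i _ ↦ ((hAinv j i).comp (x₀, v₀) hfst).mul ((hf i).comp (x₀, v₀) hfst))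
    ((hPs _ (hl j)).contDiffAt.comp (x₀, v₀) contDiffAt_snd)

end LocalRegularity

/-! ### Homogeneous polynomials and quadratic maps -/

section HomogeneousPolynomials

/-- The space of functions `v ↦ K(v, …, v)`, where `K` is a `d`-linear form. -/
noncomputable def homogeneousPolynomials (V : Type*) [AddCommGroup V] [Module ℝ V] (d : ℕ) :
    Submodule ℝ (V → ℝ) :=
  LinearMap.range
    ({ toFun := fun K v ↦ K fun _ ↦ v
       map_add' := fun _ _ ↦ rfl
       map_smul' := fun _ _ ↦ rfl } :
      MultilinearMap ℝ (fun _ : Fin d ↦ V) ℝ →ₗ[ℝ] V → ℝ)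

theorem mem_homogeneousPolynomials {V : Type*} [AddCommGroup V] [Module ℝ V] {d : ℕ}
    {f : V → ℝ} : f ∈ homogeneousPolynomials V d ↔
      ∃ K : MultilinearMap ℝ (fun _ : Fin d ↦ V) ℝ, ∀ v, f v = K fun _ ↦ v := by
  constructor
  · rintro ⟨K, rfl⟩
    exact ⟨K, fun v ↦ rfl⟩
  · rintro ⟨K, hK⟩
    exact ⟨K, funext fun v ↦ (hK v).symm⟩

instance {V : Type*} [AddCommGroup V] [Module ℝ V] [FiniteDimensional ℝ V] (d : ℕ) :
    FiniteDimensional ℝ (homogeneousPolynomials V d) := by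
  unfold homogeneousPolynomials
  infer_instance

theorem homogeneousPolynomials_apply_smul {V : Type*} [AddCommGroup V] [Module ℝ V] {d : ℕ}
    {f : V → ℝ} (hf : f ∈ homogeneousPolynomials V d) (c : ℝ) (v : V) :
    f (c • v) = c ^ d * f v := by
  obtain ⟨K, hK⟩ := mem_homogeneousPolynomials.1 hf
  rw [hK, hK, K.map_smul_univ (fun _ ↦ c) (fun _ ↦ v)]
  simp

theorem contDiff_of_mem_homogeneousPolynomials {V : Type*} [NormedAddCommGroup V]
    [NormedSpace ℝ V] [FiniteDimensional ℝ V] {d : ℕ} {m : ℕ∞ω}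
    {f : V → ℝ} (hf : f ∈ homogeneousPolynomials V d) : ContDiff ℝ m f := by
  obtain ⟨K, hK⟩ := mem_homogeneousPolynomials.1 hf
  let b := Module.finBasis ℝ V
  have h (v : V) : f v = ∑ r : Fin d → Fin (Module.finrank ℝ V),
      (∏ j, b.coord (r j) v) * K fun j ↦ b (r j) := by
    rw [hK]
    conv_lhs => rw [← b.sum_repr v]
    rw [K.map_sum]
    exact Finset.sum_congr rfl fun r _ ↦ K.map_smul_univ (fun j ↦ b.repr v (r j)) _
  rw [funext h]
  refine ContDiff.sum fun r _ ↦ (contDiff_prod fun j _ ↦ ?_).mul contDiff_const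
  exact (b.coord (r j)).toContinuousLinearMap.contDiff

end HomogeneousPolynomials

/-- A differentiable map which is quadratic in its second variable has zero derivative on the zero
section. -/
theorem hasFDerivAt_zero_of_quadratic {E F : Type*} [NormedAddCommGroup E] [NormedSpace ℝ E]
    [NormedAddCommGroup F] [NormedSpace ℝ F] {Q : E × E → F} (hQ : Differentiable ℝ Q)
    (hq : ∀ (y v : E) (c : ℝ), Q (y, c • v) = c ^ 2 • Q (y, v)) (x₀ : E) :
    HasFDerivAt Q (0 : E × E →L[ℝ] F) (x₀, 0) := by
  have h := (hQ (x₀, 0)).hasFDerivAt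
  convert h using 1
  symm
  ext1
  all_goals
    refine ContinuousLinearMap.ext fun v ↦ ?_
  · have h1 : HasDerivAt (fun t : ℝ ↦ (x₀ + t • v, (0 : E))) (v, 0) 0 := by
      have := ((hasDerivAt_id (0 : ℝ)).smul_const v).const_add x₀
      rw [one_smul] at this
      exact this.prodMk (hasDerivAt_const _ _)
    have h2 : HasDerivAt (fun t : ℝ ↦ Q (x₀ + t • v, (0 : E))) _ 0 :=
      HasFDerivAt.comp_hasDerivAt (0 : ℝ) (by simpa using h) h1
    -- Homogeneity with c = 0 makes Q vanish on the zero section.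
    have h3 : (fun t : ℝ ↦ Q (x₀ + t • v, (0 : E))) = fun _ ↦ 0 := by
      ext t
      simpa using hq (x₀ + t • v) 0 0
    rw [h3] at h2
    exact h2.unique (hasDerivAt_const _ _)
  · have h1 : HasDerivAt (fun t : ℝ ↦ (x₀, t • v)) (0, v) 0 := by
      have := (hasDerivAt_id (0 : ℝ)).smul_const v
      rw [one_smul] at this
      exact (hasDerivAt_const _ _).prodMk this
    have h2 : HasDerivAt (fun t : ℝ ↦ Q (x₀, t • v)) _ 0 :=
      HasFDerivAt.comp_hasDerivAt (0 : ℝ) (by simpa using h) h1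
    have h3 : (fun t : ℝ ↦ Q (x₀, t • v)) = fun t ↦ t ^ 2 • Q (x₀, v) := by
      ext t
      exact hq _ _ _
    rw [h3] at h2
    have h4 := ((hasDerivAt_id (0 : ℝ)).pow 2).smul_const (Q (x₀, v))
    have h5 := h2.unique h4
    simpa using h5

/-! ### The metric and its geodesics in a chart -/

namespace PseudoRiemannianMetric

variable {n : ℕ} {M : Type*} [TopologicalSpace M]
  [ChartedSpace (EuclideanSpace ℝ (Fin n)) M] [IsManifold (𝓡 n) ∞ M]

/-- The field is the tangent map of the inverse chart applied to a constant section; the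
within-version is needed because the inverse chart is smooth only on its target. -/
theorem contMDiffAt_coordField (x₀ : M) {y : EuclideanSpace ℝ (Fin n)}
    (hy : y ∈ (chartAt (EuclideanSpace ℝ (Fin n)) x₀).target) (k : ℕ)
    (v : EuclideanSpace ℝ (Fin n)) :
    ContMDiffAt (𝓡 n) ((𝓡 n).prod 𝓘(ℝ, EuclideanSpace ℝ (Fin n))) k
      (fun z ↦ Bundle.TotalSpace.mk' (EuclideanSpace ℝ (Fin n))
        (E := fun x : M ↦ TangentSpace (𝓡 n) x)
        ((chartAt (EuclideanSpace ℝ (Fin n)) x₀).symm z)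
        (mfderiv (𝓡 n) (𝓡 n) (chartAt (EuclideanSpace ℝ (Fin n)) x₀).symm z v)) y := by
  set e := chartAt (EuclideanSpace ℝ (Fin n)) x₀
  have h1 : ContMDiffOn (𝓡 n) (𝓡 n) ∞ e.symm e.target := contMDiffOn_chart_symm
  have h2 := h1.contMDiffOn_tangentMapWithin (m := k) (by exact_mod_cast le_top)
    e.open_target.uniqueMDiffOn
  have h3 : ContMDiff (𝓡 n) (𝓡 n).tangent k
      (fun z : EuclideanSpace ℝ (Fin n) ↦
        (⟨z, v⟩ : TangentBundle (𝓡 n) (EuclideanSpace ℝ (Fin n)))) := by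
    intro z
    have h4 : ContMDiffAt (𝓡 n) 𝓘(ℝ, EuclideanSpace ℝ (Fin n)) k
        (fun _ : EuclideanSpace ℝ (Fin n) ↦ v) z := contMDiffAt_const
    refine (Bundle.contMDiffAt_section (F := EuclideanSpace ℝ (Fin n))
      (E := fun w : EuclideanSpace ℝ (Fin n) ↦ TangentSpace (𝓡 n) w) (s := fun _ ↦ v) z).2
      (h4.congr_of_eventuallyEq (.of_forall fun w ↦ ?_))
    simp
  have h4 := h2.comp h3.contMDiffOn (s := e.target) (fun z hz ↦ hz)
  refine (h4.contMDiffAt (e.open_target.mem_nhds hy)).congr_of_eventuallyEq ?_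
  filter_upwards [e.open_target.mem_nhds hy] with z hz
  simp only [Function.comp_apply, tangentMapWithin]
  rw [mfderivWithin_of_isOpen e.open_target hz]

theorem contDiffAt_matrix {k : ℕ} (g : PseudoRiemannianMetric n k M) (x₀ : M)
    {y : EuclideanSpace ℝ (Fin n)} (hy : y ∈ (chartAt (EuclideanSpace ℝ (Fin n)) x₀).target)
    (i j : Fin n) :
    ContDiffAt ℝ k (fun z ↦ g.matrix (chartAt (EuclideanSpace ℝ (Fin n)) x₀) z i j) y := by
  set e := chartAt (EuclideanSpace ℝ (Fin n)) x₀
  rw [← contMDiffAt_iff_contDiffAt]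
  have h1 : ContMDiffOn (𝓡 n) (𝓡 n) ∞ e.symm e.target := contMDiffOn_chart_symm
  have hb : ContMDiffAt (𝓡 n) (𝓡 n) k e.symm y :=
    (h1.contMDiffAt (e.open_target.mem_nhds hy)).of_le (by exact_mod_cast le_top)
  have : ContMDiffAt (𝓡 n) ((𝓡 n).prod 𝓘(ℝ)) k
      (fun z ↦ Bundle.TotalSpace.mk' ℝ (E := Bundle.Trivial M ℝ) (e.symm z)
        (g.val (e.symm z)
          (mfderiv (𝓡 n) (𝓡 n) e.symm z (EuclideanSpace.single i (1 : ℝ)))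
          (mfderiv (𝓡 n) (𝓡 n) e.symm z (EuclideanSpace.single j (1 : ℝ))))) y := by
    apply ContMDiffAt.clm_bundle_apply₂ (F₁ := EuclideanSpace ℝ (Fin n))
      (F₂ := EuclideanSpace ℝ (Fin n)) (E₁ := fun x : M ↦ TangentSpace (𝓡 n) x)
      (E₂ := fun x : M ↦ TangentSpace (𝓡 n) x)
    · exact ContMDiffAt.comp y g.contMDiff.contMDiffAt hb
    · exact contMDiffAt_coordField x₀ hy k _
    · exact contMDiffAt_coordField x₀ hy k _
  rw [Bundle.contMDiffAt_totalSpace] at this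
  exact this.2

end PseudoRiemannianMetric

theorem EuclideanSpace.sum_apply_smul_single {n : ℕ} (v : EuclideanSpace ℝ (Fin n)) :
    ∑ i, v i • EuclideanSpace.single i (1 : ℝ) = v := by
  ext j
  simp [Pi.single_apply]

namespace PseudoRiemannianMetric

variable {n : ℕ} {M : Type*} [TopologicalSpace M]
  [ChartedSpace (EuclideanSpace ℝ (Fin n)) M] [IsManifold (𝓡 n) ∞ M]

/-- Lowering an index in coordinates; this links the matrix computations with the intrinsic
momentum. -/
theorem matrix_mulVec {k : ℕ∞ω} (g : PseudoRiemannianMetric n k M)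
    (e : OpenPartialHomeomorph M (EuclideanSpace ℝ (Fin n))) (y v : EuclideanSpace ℝ (Fin n))
    (i : Fin n) :
    (g.matrix e y).mulVec v i = g.val (e.symm y) (mfderiv (𝓡 n) (𝓡 n) e.symm y v)
      (mfderiv (𝓡 n) (𝓡 n) e.symm y (EuclideanSpace.single i (1 : ℝ))) := by
  rw [g.symm]
  conv_rhs => rw [← EuclideanSpace.sum_apply_smul_single v]
  simp only [Matrix.mulVec, dotProduct, matrix, Matrix.of_apply]
  erw [map_sum, map_sum]
  refine Finset.sum_congr rfl fun j _ ↦ ?_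
  erw [map_smul, map_smul]
  exact mul_comm _ _

theorem mfderiv_chart_symm_bijective (x₀ : M) {y : EuclideanSpace ℝ (Fin n)}
    (hy : y ∈ (chartAt (EuclideanSpace ℝ (Fin n)) x₀).target) :
    Function.Bijective
      (mfderiv (𝓡 n) (𝓡 n) (chartAt (EuclideanSpace ℝ (Fin n)) x₀).symm y) := by
  have : IsManifold (𝓡 n) 1 M := IsManifold.of_le (n := ∞) (by exact_mod_cast le_top)
  exact (mdifferentiable_chart (I := 𝓡 n) x₀).symm.mfderiv_bijective hy

/-- A covector is determined by its values on a coordinate frame. -/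
theorem covector_ext (x₀ : M) {y : EuclideanSpace ℝ (Fin n)}
    (hy : y ∈ (chartAt (EuclideanSpace ℝ (Fin n)) x₀).target)
    {p q : TangentSpace (𝓡 n) ((chartAt (EuclideanSpace ℝ (Fin n)) x₀).symm y) →L[ℝ] ℝ}
    (h : ∀ i : Fin n, p (mfderiv (𝓡 n) (𝓡 n) (chartAt (EuclideanSpace ℝ (Fin n)) x₀).symm y
        (EuclideanSpace.single i (1 : ℝ))) =
      q (mfderiv (𝓡 n) (𝓡 n) (chartAt (EuclideanSpace ℝ (Fin n)) x₀).symm y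
        (EuclideanSpace.single i (1 : ℝ)))) : p = q := by
  refine ContinuousLinearMap.ext fun w ↦ ?_
  suffices h' : ∀ v : EuclideanSpace ℝ (Fin n),
      p (mfderiv (𝓡 n) (𝓡 n) (chartAt (EuclideanSpace ℝ (Fin n)) x₀).symm y v) =
        q (mfderiv (𝓡 n) (𝓡 n) (chartAt (EuclideanSpace ℝ (Fin n)) x₀).symm y v) by
    obtain ⟨v, rfl⟩ := (mfderiv_chart_symm_bijective x₀ hy).2 w
    exact h' v
  intro v
  rw [← EuclideanSpace.sum_apply_smul_single v]
  erw [map_sum, map_sum, map_sum]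
  refine Finset.sum_congr rfl fun j _ ↦ ?_
  erw [map_smul, map_smul, map_smul, h j]

/-- A kernel vector would give a nonzero tangent vector that is g-orthogonal to a coordinate frame,
hence to everything. -/
theorem det_matrix_ne_zero {k : ℕ∞ω} (g : PseudoRiemannianMetric n k M) (x₀ : M)
    {y : EuclideanSpace ℝ (Fin n)} (hy : y ∈ (chartAt (EuclideanSpace ℝ (Fin n)) x₀).target) :
    (g.matrix (chartAt (EuclideanSpace ℝ (Fin n)) x₀) y).det ≠ 0 := by
  intro h0
  obtain ⟨c, hc, hc0⟩ := Matrix.exists_mulVec_eq_zero_iff.2 h0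
  set e := chartAt (EuclideanSpace ℝ (Fin n)) x₀
  let v : EuclideanSpace ℝ (Fin n) := WithLp.toLp 2 c
  have h1 : g.val (e.symm y) (mfderiv (𝓡 n) (𝓡 n) e.symm y v) = 0 := by
    refine covector_ext x₀ hy fun i ↦ ?_
    have h2 := g.matrix_mulVec e y v i
    change (g.matrix e y).mulVec c i = _ at h2
    rw [hc0] at h2
    exact h2.symm
  have h2 : mfderiv (𝓡 n) (𝓡 n) e.symm y v = 0 :=
    g.nondegenerate _ _ fun w ↦ by rw [h1]; rfl
  have h3 : v = 0 := (mfderiv_chart_symm_bijective x₀ hy).1 (h2.trans (map_zero _).symm)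
  exact hc (congrArg WithLp.ofLp h3)

/-- The one derivative lost in the final result is lost here. -/
theorem contDiffAt_christoffel {m : ℕ} (g : PseudoRiemannianMetric n ((m + 1 : ℕ) : ℕ∞ω) M) (x₀ : M)
    {y : EuclideanSpace ℝ (Fin n)} (hy : y ∈ (chartAt (EuclideanSpace ℝ (Fin n)) x₀).target)
    (i a b : Fin n) :
    ContDiffAt ℝ m (fun z ↦ g.christoffel (chartAt (EuclideanSpace ℝ (Fin n)) x₀) z i a b) y := by
  have h1 (l i j : Fin n) : ContDiffAt ℝ m
      (fun z ↦ g.partialMatrix (chartAt (EuclideanSpace ℝ (Fin n)) x₀) z l i j) y := by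
    have := (g.contDiffAt_matrix x₀ hy i j).fderiv_right (m := m) (by push_cast; exact le_rfl)
    exact this.clm_apply contDiffAt_const
  have h2 := ContDiffAt.matrix_inv_apply
    (fun i j ↦ (g.contDiffAt_matrix x₀ hy i j).of_le (m := m) (by exact_mod_cast Nat.le_succ m))
    (g.det_matrix_ne_zero x₀ hy)
  unfold christoffel
  exact contDiffAt_const.mul (ContDiffAt.sum fun l _ ↦
    (h2 i l).mul (((h1 _ _ _).add (h1 _ _ _)).sub (h1 _ _ _)))

/-- The quadratic expression `∑ Γ^i_ab v^a v^b` of the geodesic equation, multiplied by a cut-off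
function. -/
noncomputable def cutoffSpray {k : ℕ∞ω} (g : PseudoRiemannianMetric n k M) (x₀ : M)
    (χ : EuclideanSpace ℝ (Fin n) → ℝ)
    (q : EuclideanSpace ℝ (Fin n) × EuclideanSpace ℝ (Fin n)) : EuclideanSpace ℝ (Fin n) :=
  χ q.1 • WithLp.toLp 2 fun i ↦ ∑ a, ∑ b,
    g.christoffel (chartAt (EuclideanSpace ℝ (Fin n)) x₀) q.1 i a b * q.2 a * q.2 b

theorem cutoffSpray_smul {k : ℕ∞ω} (g : PseudoRiemannianMetric n k M) (x₀ : M)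
    (χ : EuclideanSpace ℝ (Fin n) → ℝ) (y v : EuclideanSpace ℝ (Fin n)) (c : ℝ) :
    g.cutoffSpray x₀ χ (y, c • v) = c ^ 2 • g.cutoffSpray x₀ χ (y, v) := by
  ext i
  simp only [cutoffSpray, PiLp.smul_apply, smul_eq_mul, Finset.mul_sum]
  exact Finset.sum_congr rfl fun a _ ↦ Finset.sum_congr rfl fun b _ ↦ by ring

/-- The cut-off makes the spray smooth on the whole model space, as the superposition operator
requires: off the chart target, where the Christoffel symbols carry no information, χ vanishes
locally. -/
theorem contDiff_cutoffSpray {m : ℕ} (g : PseudoRiemannianMetric n ((m + 1 : ℕ) : ℕ∞ω) M) (x₀ : M)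
    {χ : EuclideanSpace ℝ (Fin n) → ℝ} (hχ : ContDiff ℝ m χ)
    (hsupp : tsupport χ ⊆ (chartAt (EuclideanSpace ℝ (Fin n)) x₀).target) :
    ContDiff ℝ m (g.cutoffSpray x₀ χ) := by
  rw [contDiff_iff_contDiffAt]
  intro q
  by_cases hq : q.1 ∈ (chartAt (EuclideanSpace ℝ (Fin n)) x₀).target
  · refine (ContDiffAt.comp q hχ.contDiffAt contDiffAt_fst).smul ?_
    rw [contDiffAt_piLp]
    intro i
    simp only
    refine ContDiffAt.sum fun a _ ↦ ?_
    refine ContDiffAt.sum fun b _ ↦ ?_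
    have h1 (a : Fin n) : ContDiffAt ℝ m
        (fun q : EuclideanSpace ℝ (Fin n) × EuclideanSpace ℝ (Fin n) ↦ q.2 a) q := by
      fun_prop
    exact ((ContDiffAt.comp q (g.contDiffAt_christoffel x₀ hq i a b) contDiffAt_fst).mul
      (h1 a)).mul (h1 b)
  · have h1 : χ =ᶠ[𝓝 q.1] 0 := notMem_tsupport_iff_eventuallyEq.1 fun h ↦ hq (hsupp h)
    refine ContDiffAt.congr_of_eventuallyEq (f := fun _ ↦ (0 : EuclideanSpace ℝ (Fin n)))
      contDiffAt_const ?_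
    filter_upwards [(continuousAt_fst (p := q)).eventually h1] with z hz
    simp only [cutoffSpray]
    rw [hz]
    simp

theorem isGeodesicOn_chart_symm_comp {k : ℕ∞ω} (g : PseudoRiemannianMetric n k M) (x₀ : M)
    {χ : EuclideanSpace ℝ (Fin n) → ℝ} (hQ : Continuous (g.cutoffSpray x₀ χ))
    {c c' : ℝ → EuclideanSpace ℝ (Fin n)} {J : Set ℝ} (hJ : IsOpen J)
    (hc : ∀ t ∈ J, (c t ∈ (chartAt (EuclideanSpace ℝ (Fin n)) x₀).target ∧ χ (c t) = 1) ∧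
      HasDerivAt c (c' t) t ∧ HasDerivAt c' (-g.cutoffSpray x₀ χ (c t, c' t)) t) :
    g.IsGeodesicOn (fun t ↦ (chartAt (EuclideanSpace ℝ (Fin n)) x₀).symm (c t)) J := by
  set e := chartAt (EuclideanSpace ℝ (Fin n)) x₀
  have hd (t) (ht : t ∈ J) : deriv c =ᶠ[𝓝 t] c' := by
    filter_upwards [hJ.mem_nhds ht] with s hs using (hc s hs).2.1.deriv
  have hcont : ContinuousOn c J := fun t ht ↦ (hc t ht).2.1.continuousAt.continuousWithinAt
  have hcont' : ContinuousOn c' J := fun t ht ↦ (hc t ht).2.2.continuousAt.continuousWithinAt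
  -- Bootstrapping: the equation expresses the derivative of c' through continuous functions, so c'
  -- is C¹ and c is C².
  have h2 : ContDiffOn ℝ 1 c' J := by
    have : ContDiffOn ℝ (0 + 1) c' J := by
      rw [contDiffOn_succ_iff_deriv_of_isOpen hJ]
      refine ⟨fun t ht ↦ (hc t ht).2.2.differentiableAt.differentiableWithinAt, by simp, ?_⟩
      rw [contDiffOn_zero]
      exact ((hQ.comp_continuousOn (hcont.prodMk hcont')).neg).congr
        fun t ht ↦ (hc t ht).2.2.deriv
    simpa using this
  have h3 : ContDiffOn ℝ 2 c J := by
    have : ContDiffOn ℝ (1 + 1) c J := by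
      rw [contDiffOn_succ_iff_deriv_of_isOpen hJ]
      refine ⟨fun t ht ↦ (hc t ht).2.1.differentiableAt.differentiableWithinAt, by simp, ?_⟩
      exact h2.congr fun t ht ↦ (hc t ht).2.1.deriv
    rwa [one_add_one_eq_two] at this
  refine ⟨?_, fun t ht ↦ ⟨e, chart_mem_atlas _ x₀, e.map_target (hc t ht).1.1, fun i ↦ ?_⟩⟩
  · have h1 : ContMDiffOn (𝓡 n) (𝓡 n) ∞ e.symm e.target := contMDiffOn_chart_symm
    exact (h1.of_le (WithTop.coe_le_coe.2 le_top)).comp h3.contMDiffOn fun t ht ↦ (hc t ht).1.1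
  · have h4 : (fun s ↦ e (e.symm (c s))) =ᶠ[𝓝 t] c := by
      filter_upwards [hJ.mem_nhds ht] with s hs using e.right_inv (hc s hs).1.1
    have h5 : deriv (fun s ↦ e (e.symm (c s))) =ᶠ[𝓝 t] c' := h4.deriv.trans (hd t ht)
    rw [h5.deriv_eq, h5.eq_of_nhds, e.right_inv (hc t ht).1.1, (hc t ht).2.2.deriv]
    simp [cutoffSpray, (hc t ht).1.2, e]

theorem momentumLift_chart_symm_comp {k : ℕ∞ω} (g : PseudoRiemannianMetric n k M) (x₀ : M)
    {c : ℝ → EuclideanSpace ℝ (Fin n)} {v : EuclideanSpace ℝ (Fin n)} {t : ℝ}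
    (ht : c t ∈ (chartAt (EuclideanSpace ℝ (Fin n)) x₀).target) (hc : HasDerivAt c v t) :
    g.momentumLift (fun t ↦ (chartAt (EuclideanSpace ℝ (Fin n)) x₀).symm (c t)) t =
      ⟨(chartAt (EuclideanSpace ℝ (Fin n)) x₀).symm (c t),
        g.val ((chartAt (EuclideanSpace ℝ (Fin n)) x₀).symm (c t))
          (mfderiv (𝓡 n) (𝓡 n) (chartAt (EuclideanSpace ℝ (Fin n)) x₀).symm (c t) v)⟩ := by
  have : IsManifold (𝓡 n) 1 M := IsManifold.of_le (n := ∞) (by exact_mod_cast le_top)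
  have h1 := ((mdifferentiable_chart (I := 𝓡 n) x₀).mdifferentiableAt_symm ht).hasMFDerivAt
  have h2 := (h1.comp t hc.hasFDerivAt.hasMFDerivAt).mfderiv
  simp only [momentumLift]
  have h3 : mfderiv 𝓘(ℝ, ℝ) (𝓡 n)
      (fun t ↦ (chartAt (EuclideanSpace ℝ (Fin n)) x₀).symm (c t)) t (1 : ℝ) =
      mfderiv (𝓡 n) (𝓡 n) (chartAt (EuclideanSpace ℝ (Fin n)) x₀).symm (c t) v := by
    change mfderiv 𝓘(ℝ, ℝ) (𝓡 n)
      ((chartAt (EuclideanSpace ℝ (Fin n)) x₀).symm ∘ c) t (1 : ℝ) = _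
    rw [h2]
    exact congrArg _ (one_smul ℝ v)
  rw [h3]

end PseudoRiemannianMetric

/-! ### The integral in velocity and momentum coordinates -/

namespace PseudoRiemannianMetric

variable {n : ℕ} {M : Type*} [TopologicalSpace M]
  [ChartedSpace (EuclideanSpace ℝ (Fin n)) M] [IsManifold (𝓡 n) ∞ M]

/-- The function `F` on `T*M` as a function of the coordinates of the base point and of the
components of the velocity corresponding to the momentum. -/
noncomputable def velocityExpression {k : ℕ∞ω} (g : PseudoRiemannianMetric n k M) (x₀ : M)
    (F : CotangentBundle n M → ℝ) (y v : EuclideanSpace ℝ (Fin n)) : ℝ :=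
  F ⟨(chartAt (EuclideanSpace ℝ (Fin n)) x₀).symm y,
    g.val ((chartAt (EuclideanSpace ℝ (Fin n)) x₀).symm y)
      (mfderiv (𝓡 n) (𝓡 n) (chartAt (EuclideanSpace ℝ (Fin n)) x₀).symm y v)⟩

theorem velocityExpression_mem {d : ℕ} {k : ℕ∞ω} (g : PseudoRiemannianMetric n k M) (x₀ : M)
    {F : CotangentBundle n M → ℝ} (hpoly : IsPolynomialInMomenta d F)
    (y : EuclideanSpace ℝ (Fin n)) :
    g.velocityExpression x₀ F y ∈ homogeneousPolynomials (EuclideanSpace ℝ (Fin n)) d := by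
  obtain ⟨K, hK⟩ := hpoly ((chartAt (EuclideanSpace ℝ (Fin n)) x₀).symm y)
  let T : EuclideanSpace ℝ (Fin n) →L[ℝ]
      (TangentSpace (𝓡 n) ((chartAt (EuclideanSpace ℝ (Fin n)) x₀).symm y) →L[ℝ] ℝ) :=
    (g.val ((chartAt (EuclideanSpace ℝ (Fin n)) x₀).symm y)).comp
      (mfderiv (𝓡 n) (𝓡 n) (chartAt (EuclideanSpace ℝ (Fin n)) x₀).symm y)
  exact mem_homogeneousPolynomials.2
    ⟨K.compLinearMap fun _ ↦ T.toLinearMap, fun v ↦ hK _⟩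

theorem contDiffAt_velocityExpression {m d : ℕ} (hm : m ≠ 0)
    (g : PseudoRiemannianMetric n ((m + 1 : ℕ) : ℕ∞ω) M) (x₀ : M)
    {F : CotangentBundle n M → ℝ} (hpoly : IsPolynomialInMomenta d F) (hF : g.IsIntegral F)
    {y : EuclideanSpace ℝ (Fin n)} (hy : y ∈ (chartAt (EuclideanSpace ℝ (Fin n)) x₀).target)
    (v : EuclideanSpace ℝ (Fin n)) :
    ContDiffAt ℝ m (fun z : EuclideanSpace ℝ (Fin n) × EuclideanSpace ℝ (Fin n) ↦
      g.velocityExpression x₀ F z.1 z.2) (y, v) := by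
  obtain ⟨r, hr, hrt⟩ := Metric.nhds_basis_closedBall.mem_iff.1
    ((chartAt (EuclideanSpace ℝ (Fin n)) x₀).open_target.mem_nhds hy)
  -- χ is 1 on the ball of radius r/2, to which the curves are confined, so they are genuine
  -- geodesics; its support lies in the closed r-ball inside the chart target. Depending on position
  -- only, χ keeps the spray quadratic in the velocity.
  let χ : ContDiffBump y := ⟨r / 2, r, by positivity, by linarith⟩
  have hQ := g.contDiff_cutoffSpray x₀ (χ := χ) χ.contDiff (by rw [χ.tsupport_eq]; exact hrt)
  have hQ0 := hasFDerivAt_zero_of_quadratic (hQ.differentiable (by exact_mod_cast hm))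
    (g.cutoffSpray_smul x₀ χ) y
  have hQ1 : g.cutoffSpray x₀ χ (y, 0) = 0 := by
    simpa using g.cutoffSpray_smul x₀ χ y 0 0
  refine contDiffAt_of_conserved (d := d) hm hQ hQ1 hQ0
    (Metric.ball_mem_nhds y (half_pos hr)) (homogeneousPolynomials _ d)
    (fun f hf ↦ contDiff_of_mem_homogeneousPolynomials hf)
    (fun f hf ↦ homogeneousPolynomials_apply_smul hf)
    (fun x _ ↦ g.velocityExpression_mem x₀ hpoly x) (fun c c' hc ↦ ?_) v
  have hc1 : ∀ t ∈ Set.Ioo (-1 : ℝ) 2,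
      (c t ∈ (chartAt (EuclideanSpace ℝ (Fin n)) x₀).target ∧ χ (c t) = 1) ∧
        HasDerivAt c (c' t) t ∧ HasDerivAt c' (-g.cutoffSpray x₀ χ (c t, c' t)) t := by
    intro t ht
    have h1 := (hc t ht).1
    refine ⟨⟨hrt (Metric.ball_subset_closedBall (Metric.ball_subset_ball (by linarith) h1)),
      χ.one_of_mem_closedBall (Metric.ball_subset_closedBall h1)⟩, (hc t ht).2⟩
  have h0 : (0 : ℝ) ∈ Set.Ioo (-1 : ℝ) 2 := by norm_num
  have h1 : (1 : ℝ) ∈ Set.Ioo (-1 : ℝ) 2 := by norm_num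
  have h := hF _ (Set.Ioo (-1) 2) isOpen_Ioo Set.ordConnected_Ioo
    (g.isGeodesicOn_chart_symm_comp x₀ hQ.continuous isOpen_Ioo hc1) 0 h0 1 h1
  rwa [g.momentumLift_chart_symm_comp x₀ (hc1 0 h0).1.1 (hc1 0 h0).2.1,
    g.momentumLift_chart_symm_comp x₀ (hc1 1 h1).1.1 (hc1 1 h1).2.1] at h

/-- The inverse matrix raises the index, recovering the velocity whose lowered form is p. -/
theorem eq_velocityExpression {k : ℕ∞ω} (g : PseudoRiemannianMetric n k M) (x₀ : M)
    (F : CotangentBundle n M → ℝ) {x : M}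
    (hx : x ∈ (chartAt (EuclideanSpace ℝ (Fin n)) x₀).source)
    (p : TangentSpace (𝓡 n) x →L[ℝ] ℝ) :
    F ⟨x, p⟩ = g.velocityExpression x₀ F (chartAt (EuclideanSpace ℝ (Fin n)) x₀ x)
      (WithLp.toLp 2 ((g.matrix (chartAt (EuclideanSpace ℝ (Fin n)) x₀)
        (chartAt (EuclideanSpace ℝ (Fin n)) x₀ x))⁻¹.mulVec fun j ↦
          p (mfderiv (𝓡 n) (𝓡 n) (chartAt (EuclideanSpace ℝ (Fin n)) x₀).symm
            (chartAt (EuclideanSpace ℝ (Fin n)) x₀ x)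
            (EuclideanSpace.single j (1 : ℝ))))) := by
  obtain ⟨y, hy, rfl⟩ : ∃ y ∈ (chartAt (EuclideanSpace ℝ (Fin n)) x₀).target,
      (chartAt (EuclideanSpace ℝ (Fin n)) x₀).symm y = x :=
    ⟨_, (chartAt _ x₀).map_source hx, (chartAt _ x₀).left_inv hx⟩
  rw [(chartAt (EuclideanSpace ℝ (Fin n)) x₀).right_inv hy]
  unfold velocityExpression
  congr 2
  refine covector_ext x₀ hy fun i ↦ ?_
  rw [← g.matrix_mulVec, Matrix.mulVec_mulVec, Matrix.mul_nonsing_inv _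
    (isUnit_iff_ne_zero.2 (g.det_matrix_ne_zero x₀ hy)), Matrix.one_mulVec]

/-- The components of the momentum in a chart are smooth functions on the cotangent bundle. -/
theorem contMDiffAt_momentum (q₀ : CotangentBundle n M) (k : ℕ)
    (v : EuclideanSpace ℝ (Fin n)) :
    ContMDiffAt ((𝓡 n).prod 𝓘(ℝ, EuclideanSpace ℝ (Fin n) →L[ℝ] ℝ)) 𝓘(ℝ, ℝ) k
      (fun q : CotangentBundle n M ↦ (q.2
        (mfderiv (𝓡 n) (𝓡 n) (chartAt (EuclideanSpace ℝ (Fin n)) q₀.1).symm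
          (chartAt (EuclideanSpace ℝ (Fin n)) q₀.1 q.1) v) : ℝ)) q₀ := by
  set e := chartAt (EuclideanSpace ℝ (Fin n)) q₀.1
  have hproj : ContMDiff ((𝓡 n).prod 𝓘(ℝ, EuclideanSpace ℝ (Fin n) →L[ℝ] ℝ)) (𝓡 n) k
      (fun q : CotangentBundle n M ↦ q.1) := Bundle.contMDiff_proj _
  have he : ContMDiffOn (𝓡 n) (𝓡 n) ∞ e e.source := contMDiffOn_chart
  have he' : ContMDiffAt (𝓡 n) (𝓡 n) k e q₀.1 :=
    (he.contMDiffAt (e.open_source.mem_nhds (mem_chart_source _ _))).of_le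
      (by exact_mod_cast le_top)
  have h1 : ContMDiffAt ((𝓡 n).prod 𝓘(ℝ, EuclideanSpace ℝ (Fin n) →L[ℝ] ℝ)) (𝓡 n) k
      (fun q : CotangentBundle n M ↦ e q.1) q₀ := he'.comp q₀ hproj.contMDiffAt
  have hfield : ContMDiffAt ((𝓡 n).prod 𝓘(ℝ, EuclideanSpace ℝ (Fin n) →L[ℝ] ℝ))
      ((𝓡 n).prod 𝓘(ℝ, EuclideanSpace ℝ (Fin n))) k
      (fun q : CotangentBundle n M ↦ Bundle.TotalSpace.mk' (EuclideanSpace ℝ (Fin n))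
        (E := fun x : M ↦ TangentSpace (𝓡 n) x) q.1
        (mfderiv (𝓡 n) (𝓡 n) e.symm (e q.1) v)) q₀ := by
    refine ((contMDiffAt_coordField q₀.1 (e.map_source (mem_chart_source _ _)) k v).comp q₀
      h1).congr_of_eventuallyEq ?_
    filter_upwards [hproj.continuous.continuousAt.eventually_mem
      (e.open_source.mem_nhds (mem_chart_source _ q₀.1))] with q hq
    -- The base points agree only propositionally, while all tangent spaces are the same model
    -- space.
    have h2 (x x' : M) (hx : x = x') (a : EuclideanSpace ℝ (Fin n)) :
        Bundle.TotalSpace.mk' (EuclideanSpace ℝ (Fin n))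
          (E := fun x : M ↦ TangentSpace (𝓡 n) x) x a =
        Bundle.TotalSpace.mk' (EuclideanSpace ℝ (Fin n))
          (E := fun x : M ↦ TangentSpace (𝓡 n) x) x' a := by
      subst hx; rfl
    exact h2 _ _ (e.left_inv hq).symm _
  have h3 : ContMDiffAt ((𝓡 n).prod 𝓘(ℝ, EuclideanSpace ℝ (Fin n) →L[ℝ] ℝ))
      ((𝓡 n).prod 𝓘(ℝ)) k
      (fun q : CotangentBundle n M ↦ Bundle.TotalSpace.mk' ℝ (E := Bundle.Trivial M ℝ) q.1
        (q.2 (mfderiv (𝓡 n) (𝓡 n) e.symm (e q.1) v))) q₀ := by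
    apply ContMDiffAt.clm_bundle_apply (F₁ := EuclideanSpace ℝ (Fin n))
      (E₁ := fun x : M ↦ TangentSpace (𝓡 n) x)
    · exact contMDiffAt_id
    · exact hfield
  rw [Bundle.contMDiffAt_totalSpace] at h3
  exact h3.2

/-- An integral of the geodesic flow which is polynomial in momenta is as smooth as the
Christoffel symbols. -/
theorem contMDiff_of_isIntegral {m d : ℕ} (hm : m ≠ 0)
    (g : PseudoRiemannianMetric n ((m + 1 : ℕ) : ℕ∞ω) M)
    {F : CotangentBundle n M → ℝ} (hpoly : IsPolynomialInMomenta d F) (hF : g.IsIntegral F) :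
    ContMDiff ((𝓡 n).prod 𝓘(ℝ, EuclideanSpace ℝ (Fin n) →L[ℝ] ℝ)) 𝓘(ℝ, ℝ) m F := by
  intro q₀
  set e := chartAt (EuclideanSpace ℝ (Fin n)) q₀.1
  have hproj : ContMDiff ((𝓡 n).prod 𝓘(ℝ, EuclideanSpace ℝ (Fin n) →L[ℝ] ℝ)) (𝓡 n) m
      (fun q : CotangentBundle n M ↦ q.1) := Bundle.contMDiff_proj _
  have he : ContMDiffOn (𝓡 n) (𝓡 n) ∞ e e.source := contMDiffOn_chart
  have he' : ContMDiffAt (𝓡 n) (𝓡 n) m e q₀.1 :=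
    (he.contMDiffAt (e.open_source.mem_nhds (mem_chart_source _ _))).of_le
      (by exact_mod_cast le_top)
  have h1 : ContMDiffAt ((𝓡 n).prod 𝓘(ℝ, EuclideanSpace ℝ (Fin n) →L[ℝ] ℝ)) (𝓡 n) m
      (fun q : CotangentBundle n M ↦ e q.1) q₀ := he'.comp q₀ hproj.contMDiffAt
  let mom : CotangentBundle n M → Fin n → ℝ := fun q j ↦
    q.2 (mfderiv (𝓡 n) (𝓡 n) e.symm (e q.1) (EuclideanSpace.single j (1 : ℝ)))
  have h2 : ContMDiffAt ((𝓡 n).prod 𝓘(ℝ, EuclideanSpace ℝ (Fin n) →L[ℝ] ℝ))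
      𝓘(ℝ, Fin n → ℝ) m mom q₀ :=
    contMDiffAt_pi_space.2 fun j ↦ contMDiffAt_momentum q₀ m _
  have hy : e q₀.1 ∈ e.target := e.map_source (mem_chart_source _ _)
  let Ψ : EuclideanSpace ℝ (Fin n) × (Fin n → ℝ) → ℝ := fun z ↦
    g.velocityExpression q₀.1 F z.1 (WithLp.toLp 2 ((g.matrix e z.1)⁻¹.mulVec z.2))
  have hΨ : ContDiffAt ℝ m Ψ (e q₀.1, mom q₀) := by
    have h3 := ContDiffAt.matrix_inv_apply
      (fun i j ↦ (g.contDiffAt_matrix q₀.1 hy i j).of_le (m := m)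
        (by exact_mod_cast Nat.le_succ m)) (g.det_matrix_ne_zero q₀.1 hy)
    have h4 : ContDiffAt ℝ m (fun z : EuclideanSpace ℝ (Fin n) × (Fin n → ℝ) ↦
        (WithLp.toLp 2 ((g.matrix e z.1)⁻¹.mulVec z.2) : EuclideanSpace ℝ (Fin n)))
        (e q₀.1, mom q₀) := by
      rw [contDiffAt_piLp]
      intro i
      simp only [Matrix.mulVec, dotProduct]
      refine ContDiffAt.sum fun j _ ↦ ContDiffAt.mul ?_ ?_
      · exact ContDiffAt.comp (e q₀.1, mom q₀) (h3 i j) contDiffAt_fst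
      · fun_prop
    exact ContDiffAt.comp (e q₀.1, mom q₀)
      (g := fun z : EuclideanSpace ℝ (Fin n) × EuclideanSpace ℝ (Fin n) ↦
        g.velocityExpression q₀.1 F z.1 z.2)
      (g.contDiffAt_velocityExpression hm q₀.1 hpoly hF hy _) (contDiffAt_fst.prodMk h4)
  refine ContMDiffAt.congr_of_eventuallyEq (f := fun q ↦ Ψ (e q.1, mom q)) ?_ ?_
  · exact ContMDiffAt.comp (g := Ψ) q₀ hΨ.contMDiffAt (h1.prodMk_space h2)
  · filter_upwards [hproj.continuous.continuousAt.eventually_mem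
      (e.open_source.mem_nhds (mem_chart_source _ q₀.1))] with q hq
    exact g.eq_velocityExpression q₀.1 F hq q.2

end PseudoRiemannianMetric

theorem corollary1 {n d k : ℕ} (hk : 2 ≤ k) {M : Type*} [TopologicalSpace M]
    [ChartedSpace (EuclideanSpace ℝ (Fin n)) M] [IsManifold (𝓡 n) ∞ M]
    (g : PseudoRiemannianMetric n (k : ℕ∞ω) M) (F : CotangentBundle n M → ℝ)
    (hpoly : IsPolynomialInMomenta d F) (hF : g.IsIntegral F) :
    ContMDiff ((𝓡 n).prod 𝓘(ℝ, EuclideanSpace ℝ (Fin n) →L[ℝ] ℝ)) 𝓘(ℝ, ℝ)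
      ((k - 1 : ℕ) : ℕ∞ω) F := by
  -- Since k ≥ 2, m is at least 1, as the inverse function theorem demands.
  obtain ⟨m, rfl⟩ : ∃ m, k = m + 1 := ⟨k - 1, by omega⟩
  exact g.contMDiff_of_isIntegral (by omega) hpoly hF
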